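/- **Setting.** A *generalized Cartan matrix* (GCM) is a square matrix $M=(M_{ij})_{i,j\in I}$ of integers, indexed by a finite set $I$, with $M_{ii}=2$, with $M_{ij}\le 0$ for $i\neq j$, and with $M_{ij}\ne0\Rightarrow M_{ji}\neq 0$. Its graph has node set $I$, and $i\ne j$ are adjacent when $M_{ij}$ and $M_{ji}$ are nonzero; the graph together with $M$ is a *GCM graph*, and GCM graphs that differ by a bijection of the index sets are identified. A *position* is a vector $\lambda\in\mathbb{R}^I$; it is *dominant* if all $\lambda_i\ge 0$. A node $i$ may be *fired* when $\lambda_i>0$; this replaces each $\lambda_j$ by $\lambda_j-M_{ij}\lambda_i$. A *convergent game sequence* for $\lambda$ is a finite (possibly empty) sequence of nodes that can be legally fired one after another starting at $\lambda$, after which no node has a positive number. A connected GCM graph is *admissible* if some nonzero dominant position has a convergent game sequence. **Proposition 3.1.** Each of the following is a connected GCM graph that is not admissible. (The off-diagonal entries $M_{ij}$ are $0$ for nodes that are not joined by an edge, and both entries of an edge are $-1$ unless stated otherwise.) * $\widetilde{\mathsf A}$: the cycle on $n\ge3$ nodes. * $\widetilde{\mathsf B}$: (i) for $n\geq 4$,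 nodes $1$ and $2$ both joined to $3$, and the path $3-4-\cdots-n$, with $M_{n-1,n}=-2$; (ii) for $n\ge3$, the path $1-2-\cdots-n$ with $M_{21}=-2$ and $M_{n-1,n}=-2$. * $\widetilde{\mathsf C}$: for $n\ge 3$, the path $1-2-\cdots-n$ (i) with $M_{12}=-2$ and $M_{n,n-1}=-2$, or (ii) with $M_{21}=-2$ and $M_{n,n-1}=-2$; (iii) for $n\ge4$, the graph of $\widetilde{\mathsf B}$(i) but with $M_{n-1,n}=-1$ and $M_{n,n-1}=-2$. * $\widetilde{\mathsf D}$: for $n\ge5$, nodes $1,2$ joined to $3$, the path $3-\cdots-(n-2)$, and nodes $n-1,n$ joined to $n-2$. * $\widetilde{\mathsf E}$: the tree with the paths $1-4-5-6-7$ and $2-3-5$; the tree with the paths $1-3-4-5-6-7-8$ and $2-5$; the tree with the paths $1-3-4-5-6-7-8-9$ and $2-4$. * $\widetilde{\mathsf F}$: the path $1-2-3-4-5$ with $M_{23}=-2$, or with $M_{32}=-2$. * $\widetilde{\mathsf G}$: the path $1-2-3$ with $(-M_{12},-M_{21},-M_{23},-M_{32})$ equal to $(1,3,1,1)$, $(1,3,1,2)$,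 $(1,3,1,3)$, $(3,1,1,1)$, $(1,3,2,1)$ or $(1,3,3,1)$. * Triangles on nodes $a,b,c$ with $M_{ab}=-m$, $M_{ba}=-1$, $M_{ac}=-p_1$, $M_{ca}=-q_1$, $M_{bc}=-p_2$, $M_{cb}=-q_2$, where $m\in\{1,2,3\}$ and $p_1,q_1,p_2,q_2$ are positive integers with $p_1q_1\ge m$ and $p_2q_2\ge m$. * The 4-cycles $1-2-3-4-1$ with $M_{12}=-2$ and with $(M_{34},M_{43})$ equal to $(-1,-1)$, $(-1,-2)$ or $(-2,-1)$. * The 5-cycle $1-2-3-4-5-1$ with $M_{12}=-2$. Thus no nonzero dominant initial position on any of these graphs has a convergent game sequence. -/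

import Mathlib

namespace NumbersGame

/-- A generalized Cartan matrix. -/
structure IsGCM {ι : Type*} (M : Matrix ι ι ℤ) : Prop where
  diag : ∀ i, M i i = 2
  nonpos : ∀ i j, i ≠ j → M i j ≤ 0
  ne_zero_symm : ∀ i j, M i j ≠ 0 → M j i ≠ 0

/-- The graph `Γ` associated with a generalized Cartan matrix. -/
def graph {ι : Type*} (M : Matrix ι ι ℤ) : SimpleGraph ι where
  Adj i j := i ≠ j ∧ M i j ≠ 0 ∧ M j i ≠ 0
  symm := ⟨fun _ _ h => ⟨h.1.symm, h.2.2, h.2.1⟩⟩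
  loopless := ⟨fun _ h => h.1 rfl⟩

/-- The position obtained from the position `x` by firing node `i`. -/
def fire {ι : Type*} (M : Matrix ι ι ℤ) (x : ι → ℝ) (i : ι) : ι → ℝ :=
  fun j => x j - (M i j : ℝ) * x i

/-- The position obtained from `x` by firing the nodes of a list one after another. -/
def play {ι : Type*} (M : Matrix ι ι ℤ) : (ι → ℝ) → List ι → (ι → ℝ)
  | x, [] => x
  | x, i :: s => play M (fire M x i) s

/-- Each node of the list has a positive number at the moment when it is fired. -/
def LegalFiringSequence {ι : Type*} (M : Matrix ι ι ℤ) : (ι → ℝ) → List ι → Prop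
  | _, [] => True
  | x, i :: s => 0 < x i ∧ LegalFiringSequence M (fire M x i) s

/-- A convergent game sequence for `x`: a finite legal firing sequence after which no node
has a positive number. -/
def ConvergentGameSequence {ι : Type*} (M : Matrix ι ι ℤ) (x : ι → ℝ) (s : List ι) : Prop :=
  LegalFiringSequence M x s ∧ ∀ i, play M x s i ≤ 0

/-- Some nonzero dominant initial position has a convergent game sequence. -/
def Admissible {ι : Type*} (M : Matrix ι ι ℤ) : Prop :=
  ∃ x : ι → ℝ, (∀ i, 0 ≤ x i) ∧ x ≠ 0 ∧ ∃ s : List ι, ConvergentGameSequence M x s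

/-- The matrix with diagonal entries `2` and with entry `- a i j` in row `i` and column `j ≠ i`,
where the nodes are numbered `1, …, n`. -/
def ofAmplitudes (n : ℕ) (a : ℕ → ℕ → ℕ) : Matrix (Fin n) (Fin n) ℤ :=
  Matrix.of fun i j => if i = j then 2 else -(a (i + 1) (j + 1) : ℤ)

/-- Adjacency in the path `1 - 2 - 3 - ⋯`. -/
abbrev PathAdj (i j : ℕ) : Prop := i + 1 = j ∨ j + 1 = i

/-- Adjacency in the graph in which `1` and `2` are both joined to `3`, followed by the path
`3 - 4 - 5 - ⋯`. -/
abbrev ForkAdj (i j : ℕ) : Prop :=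
  (i = 1 ∧ j = 3) ∨ (j = 1 ∧ i = 3) ∨ (2 ≤ i ∧ i + 1 = j) ∨ (2 ≤ j ∧ j + 1 = i)

/-- The `n`-cycle `1 - 2 - ⋯ - n - 1`. -/
def tildeA (n : ℕ) : Matrix (Fin n) (Fin n) ℤ :=
  ofAmplitudes n fun i j =>
    if PathAdj i j ∨ (i = 1 ∧ j = n) ∨ (i = n ∧ j = 1) then 1 else 0

/-- A fork at `1, 2, 3`, and amplitudes `M (n-1) n = -2`, `M n (n-1) = -1` on the last edge. -/
def tildeB (n : ℕ) : Matrix (Fin n) (Fin n) ℤ :=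
  ofAmplitudes n fun i j =>
    if i + 1 = n ∧ j = n then 2 else if ForkAdj i j then 1 else 0

/-- A path with `M 1 2 = -1`, `M 2 1 = -2`, `M (n-1) n = -2`, `M n (n-1) = -1`. -/
def tildeB' (n : ℕ) : Matrix (Fin n) (Fin n) ℤ :=
  ofAmplitudes n fun i j =>
    if (i = 2 ∧ j = 1) ∨ (i + 1 = n ∧ j = n) then 2 else if PathAdj i j then 1 else 0

/-- A path with `M 1 2 = -2`, `M 2 1 = -1`, `M (n-1) n = -1`, `M n (n-1) = -2`. -/
def tildeC (n : ℕ) : Matrix (Fin n) (Fin n) ℤ :=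
  ofAmplitudes n fun i j =>
    if (i = 1 ∧ j = 2) ∨ (i = n ∧ j + 1 = n) then 2 else if PathAdj i j then 1 else 0

/-- A path with `M 1 2 = -1`, `M 2 1 = -2`, `M (n-1) n = -1`, `M n (n-1) = -2`. -/
def tildeC' (n : ℕ) : Matrix (Fin n) (Fin n) ℤ :=
  ofAmplitudes n fun i j =>
    if (i = 2 ∧ j = 1) ∨ (i = n ∧ j + 1 = n) then 2 else if PathAdj i j then 1 else 0

/-- A fork at `1, 2, 3`, and amplitudes `M (n-1) n = -1`, `M n (n-1) = -2` on the last edge. -/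
def tildeC'' (n : ℕ) : Matrix (Fin n) (Fin n) ℤ :=
  ofAmplitudes n fun i j =>
    if i = n ∧ j + 1 = n then 2 else if ForkAdj i j then 1 else 0

/-- Nodes `1` and `2` are joined to `3`, nodes `n - 1` and `n` are joined to `n - 2`, and
`3 - 4 - ⋯ - (n - 2)` is a path. -/
def tildeD (n : ℕ) : Matrix (Fin n) (Fin n) ℤ :=
  ofAmplitudes n fun i j =>
    if (ForkAdj i j ∧ i < n ∧ j < n) ∨ (i + 2 = n ∧ j = n) ∨ (i = n ∧ j + 2 = n) then 1 else 0

/-- The edges are `1 - 4 - 5 - 6 - 7` and `2 - 3 - 5`. -/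
def tildeE6 : Matrix (Fin 7) (Fin 7) ℤ :=
  !![ 2,  0,  0, -1,  0,  0,  0;
      0,  2, -1,  0,  0,  0,  0;
      0, -1,  2,  0, -1,  0,  0;
     -1,  0,  0,  2, -1,  0,  0;
      0,  0, -1, -1,  2, -1,  0;
      0,  0,  0,  0, -1,  2, -1;
      0,  0,  0,  0,  0, -1,  2]

/-- The edges are `1 - 3 - 4 - 5 - 6 - 7 - 8` and `2 - 5`. -/
def tildeE7 : Matrix (Fin 8) (Fin 8) ℤ :=
  !![ 2,  0, -1,  0,  0,  0,  0,  0;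
      0,  2,  0,  0, -1,  0,  0,  0;
     -1,  0,  2, -1,  0,  0,  0,  0;
      0,  0, -1,  2, -1,  0,  0,  0;
      0, -1,  0, -1,  2, -1,  0,  0;
      0,  0,  0,  0, -1,  2, -1,  0;
      0,  0,  0,  0,  0, -1,  2, -1;
      0,  0,  0,  0,  0,  0, -1,  2]

/-- The edges are `1 - 3 - 4 - 5 - 6 - 7 - 8 - 9` and `2 - 4`. -/
def tildeE8 : Matrix (Fin 9) (Fin 9) ℤ :=
  !![ 2,  0, -1,  0,  0,  0,  0,  0,  0;
      0,  2,  0, -1,  0,  0,  0,  0,  0;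
     -1,  0,  2, -1,  0,  0,  0,  0,  0;
      0, -1, -1,  2, -1,  0,  0,  0,  0;
      0,  0,  0, -1,  2, -1,  0,  0,  0;
      0,  0,  0,  0, -1,  2, -1,  0,  0;
      0,  0,  0,  0,  0, -1,  2, -1,  0;
      0,  0,  0,  0,  0,  0, -1,  2, -1;
      0,  0,  0,  0,  0,  0,  0, -1,  2]

/-- The five-node path in which the edge between nodes `2` and `3` has amplitudes
`M 2 3 = -p`, `M 3 2 = -q` and all other amplitudes are `-1`. -/
def fivePath (p q : ℤ) : Matrix (Fin 5) (Fin 5) ℤ :=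
  !![ 2, -1,  0,  0,  0;
     -1,  2, -p,  0,  0;
      0, -q,  2, -1,  0;
      0,  0, -1,  2, -1;
      0,  0,  0, -1,  2]

/-- The three-node path with `M 1 2 = -p`, `M 2 1 = -q`, `M 2 3 = -r`, `M 3 2 = -s`. -/
def threePath (p q r s : ℤ) : Matrix (Fin 3) (Fin 3) ℤ :=
  !![ 2, -p,  0;
     -q,  2, -r;
      0, -s,  2]

/-- The triangle with nodes `a, b, c` (in this order) and amplitudes
`M a b = -m`, `M b a = -1`, `M a c = -p₁`, `M c a = -q₁`, `M b c = -p₂`, `M c b = -q₂`. -/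
def triangle (m p₁ q₁ p₂ q₂ : ℤ) : Matrix (Fin 3) (Fin 3) ℤ :=
  !![  2,  -m, -p₁;
      -1,   2, -p₂;
     -q₁, -q₂,   2]

/-- The four-cycle `1 - 2 - 3 - 4 - 1` with `M 1 2 = -2`, `M 2 1 = -1`, `M 3 4 = -p`,
`M 4 3 = -q` and all other amplitudes equal to `-1`. -/
def fourCycle (p q : ℤ) : Matrix (Fin 4) (Fin 4) ℤ :=
  !![ 2, -2,  0, -1;
     -1,  2, -1,  0;
      0, -1,  2, -p;
     -1,  0, -q,  2]

/-- The five-cycle `1 - 2 - 3 - 4 - 5 - 1` with `M 1 2 = -2` and all other amplitudes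
equal to `-1`. -/
def fiveCycle : Matrix (Fin 5) (Fin 5) ℤ :=
  !![ 2, -2,  0,  0, -1;
     -1,  2, -1,  0,  0;
      0, -1,  2, -1,  0;
      0,  0, -1,  2, -1;
     -1,  0,  0, -1,  2]

/-- The list of matrices, one numbering of the nodes being chosen for each graph. -/
inductive Listed : (n : ℕ) → Matrix (Fin n) (Fin n) ℤ → Prop
  | A (n : ℕ) : 3 ≤ n → Listed n (tildeA n)
  | B (n : ℕ) : 4 ≤ n → Listed n (tildeB n)
  | B' (n : ℕ) : 3 ≤ n → Listed n (tildeB' n)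
  | C (n : ℕ) : 3 ≤ n → Listed n (tildeC n)
  | C' (n : ℕ) : 3 ≤ n → Listed n (tildeC' n)
  | C'' (n : ℕ) : 4 ≤ n → Listed n (tildeC'' n)
  | D (n : ℕ) : 5 ≤ n → Listed n (tildeD n)
  | E6 : Listed 7 tildeE6
  | E7 : Listed 8 tildeE7
  | E8 : Listed 9 tildeE8
  | F : Listed 5 (fivePath 2 1)
  | F' : Listed 5 (fivePath 1 2)
  | G₁ : Listed 3 (threePath 1 3 1 1)
  | G₂ : Listed 3 (threePath 1 3 1 2)
  | G₃ : Listed 3 (threePath 1 3 1 3)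
  | G₄ : Listed 3 (threePath 3 1 1 1)
  | G₅ : Listed 3 (threePath 1 3 2 1)
  | G₆ : Listed 3 (threePath 1 3 3 1)
  | triangle₁ (p₁ q₁ p₂ q₂ : ℤ) : 1 ≤ p₁ → 1 ≤ q₁ → 1 ≤ p₂ → 1 ≤ q₂ →
      Listed 3 (triangle 1 p₁ q₁ p₂ q₂)
  | triangle₂ (p₁ q₁ p₂ q₂ : ℤ) : 1 ≤ p₁ → 1 ≤ q₁ → 1 ≤ p₂ → 1 ≤ q₂ →
      2 ≤ p₁ * q₁ → 2 ≤ p₂ * q₂ → Listed 3 (triangle 2 p₁ q₁ p₂ q₂)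
  | triangle₃ (p₁ q₁ p₂ q₂ : ℤ) : 1 ≤ p₁ → 1 ≤ q₁ → 1 ≤ p₂ → 1 ≤ q₂ →
      3 ≤ p₁ * q₁ → 3 ≤ p₂ * q₂ → Listed 3 (triangle 3 p₁ q₁ p₂ q₂)
  | square₁ : Listed 4 (fourCycle 1 1)
  | square₂ : Listed 4 (fourCycle 1 2)
  | square₃ : Listed 4 (fourCycle 2 1)
  | pentagon : Listed 5 fiveCycle

/-- `M` is, up to a bijection between the index sets, one of the listed matrices. -/
def IsListed {ι : Type*} (M : Matrix ι ι ℤ) : Prop :=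
  ∃ (n : ℕ) (A : Matrix (Fin n) (Fin n) ℤ), Listed n A ∧
    ∃ e : ι ≃ Fin n, ∀ i j, M i j = A (e i) (e j)

end NumbersGame

/-!
Each listed matrix `M` has a positive vector `v` with `M v ≤ 0`; if `M` is affine, `v` spans the
kernel of `M`. Firing a node `i` of a position `x` subtracts `x i` times the `i`-th row of `M`,
hence changes `⟨x, v⟩` by `-x i * (M v) i ≥ 0`. A nonzero dominant position starts with
`⟨x, v⟩ > 0`, while a position without positive entries has `⟨x, v⟩ ≤ 0`, so the game cannot
terminate.
-/

namespace NumbersGame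

open Finset Matrix

section Game

variable {ι : Type*} [Fintype ι] {M : Matrix ι ι ℤ}

theorem fire_dotProduct (M : Matrix ι ι ℤ) (x v : ι → ℝ) (i : ι) :
    fire M x i ⬝ᵥ v = x ⬝ᵥ v - x i * (M.map (Int.cast : ℤ → ℝ) *ᵥ v) i := by
  simp only [dotProduct, mulVec, fire, map_apply, mul_sum, ← sum_sub_distrib]
  exact sum_congr rfl fun j _ => by ring

theorem LegalFiringSequence.dotProduct_le_play {v : ι → ℝ}
    (hv : ∀ i, (M.map (Int.cast : ℤ → ℝ) *ᵥ v) i ≤ 0) {x : ι → ℝ} {s : List ι}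
    (hs : LegalFiringSequence M x s) : x ⬝ᵥ v ≤ play M x s ⬝ᵥ v := by
  induction s generalizing x with
  | nil => exact le_rfl
  | cons i s ih =>
    calc x ⬝ᵥ v ≤ fire M x i ⬝ᵥ v := by
          rw [fire_dotProduct]
          exact (le_sub_self_iff _).2 (mul_nonpos_of_nonneg_of_nonpos hs.1.le (hv i))
      _ ≤ play M (fire M x i) s ⬝ᵥ v := ih hs.2

theorem not_admissible_of_mulVec_nonpos {v : ι → ℝ} (hpos : ∀ i, 0 < v i)
    (hv : ∀ i, (M.map (Int.cast : ℤ → ℝ) *ᵥ v) i ≤ 0) : ¬ Admissible M := by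
  rintro ⟨x, hx, hx0, s, hs, hend⟩
  obtain ⟨i, hi⟩ := Function.ne_iff.1 hx0
  have initial_pos : 0 < x ⬝ᵥ v :=
    sum_pos' (fun j _ => mul_nonneg (hx j) (hpos j).le)
      ⟨i, mem_univ i, mul_pos ((hx i).lt_of_ne' hi) (hpos i)⟩
  have final_nonpos : play M x s ⬝ᵥ v ≤ 0 :=
    sum_nonpos fun j _ => mul_nonpos_of_nonpos_of_nonneg (hend j) (hpos j).le
  exact (initial_pos.trans_le (hs.dotProduct_le_play hv)).not_ge final_nonpos

end Game

section Graph

theorem connected_of_exists_adj_lt {V α : Type*} [Preorder α] [WellFoundedLT α]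
    {G : SimpleGraph V} (root : V) (rank : V → α)
    (h : ∀ v, v ≠ root → ∃ w, G.Adj v w ∧ rank w < rank v) : G.Connected := by
  have reachable_root (v : V) : G.Reachable v root := by
    induction v using (InvImage.wf rank wellFounded_lt).induction with
    | _ v ih =>
      obtain rfl | hv := eq_or_ne v root
      · rfl
      · obtain ⟨w, hvw, hlt⟩ := h v hv
        exact hvw.reachable.trans (ih w hlt)
  exact {
    preconnected := fun v w => (reachable_root v).trans (reachable_root w).symm
    nonempty := ⟨root⟩ }

variable {ι κ : Type*} {M : Matrix ι ι ℤ}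

theorem IsGCM.adj_iff (hM : IsGCM M) {i j : ι} : (graph M).Adj i j ↔ i ≠ j ∧ M i j ≠ 0 :=
  ⟨fun h => ⟨h.1, h.2.1⟩, fun h => ⟨h.1, h.2, hM.ne_zero_symm i j h.2⟩⟩

theorem IsGCM.submatrix (hM : IsGCM M) {f : κ → ι} (hf : f.Injective) :
    IsGCM (M.submatrix f f) where
  diag _ := hM.diag _
  nonpos _ _ hij := hM.nonpos _ _ (hf.ne hij)
  ne_zero_symm _ _ := hM.ne_zero_symm _ _

theorem graph_submatrix (M : Matrix ι ι ℤ) {f : κ → ι} (hf : f.Injective) :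
    graph (M.submatrix f f) = (graph M).comap f := by
  ext i j
  simp only [graph, submatrix_apply, SimpleGraph.comap_adj, hf.ne_iff]

-- The quantifiers range over pairs because instance search does not find the decidability of the
-- curried conditions.
instance [Fintype ι] [DecidableEq ι] (M : Matrix ι ι ℤ) : Decidable (IsGCM M) :=
  decidable_of_iff
    ((∀ i, M i i = 2) ∧ (∀ p : ι × ι, p.1 ≠ p.2 → M p.1 p.2 ≤ 0) ∧
      ∀ p : ι × ι, M p.1 p.2 ≠ 0 → M p.2 p.1 ≠ 0)
    ⟨fun h => ⟨h.1, fun i j => h.2.1 (i, j), fun i j => h.2.2 (i, j)⟩,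
      fun h => ⟨h.diag, fun p => h.nonpos p.1 p.2, fun p => h.ne_zero_symm p.1 p.2⟩⟩

instance [DecidableEq ι] (M : Matrix ι ι ℤ) : DecidableRel (graph M).Adj :=
  fun i j => inferInstanceAs (Decidable (i ≠ j ∧ M i j ≠ 0 ∧ M j i ≠ 0))

end Graph

/-- `M` is the matrix of a connected GCM graph and has a positive integral vector `v` with
`M v ≤ 0`. By the trichotomy of indecomposable generalized Cartan matrices such a vector exists
exactly when `M` is of affine or indefinite type. -/
structure IsNonFiniteType {ι : Type*} [Fintype ι] (M : Matrix ι ι ℤ) : Prop where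
  isGCM : IsGCM M
  connected : (graph M).Connected
  exists_mulVec_nonpos : ∃ v : ι → ℤ, (∀ i, 0 < v i) ∧ ∀ i, (M *ᵥ v) i ≤ 0

namespace IsNonFiniteType

variable {ι κ : Type*} [Fintype ι] [Fintype κ] {M : Matrix ι ι ℤ}

theorem not_admissible (hM : IsNonFiniteType M) : ¬ Admissible M := by
  obtain ⟨v, hpos, hv⟩ := hM.exists_mulVec_nonpos
  exact not_admissible_of_mulVec_nonpos (v := (↑) ∘ v) (fun i => Int.cast_pos.2 (hpos i))
    fun i => ((Int.castRingHom ℝ).map_mulVec M v i).symm.trans_le (Int.cast_nonpos.2 (hv i))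

theorem submatrix (hM : IsNonFiniteType M) (e : κ ≃ ι) : IsNonFiniteType (M.submatrix e e) where
  isGCM := hM.isGCM.submatrix e.injective
  connected := by
    rw [graph_submatrix M e.injective]
    exact (SimpleGraph.Iso.comap e (graph M)).connected_iff.2 hM.connected
  exists_mulVec_nonpos := by
    obtain ⟨v, hpos, hv⟩ := hM.exists_mulVec_nonpos
    refine ⟨v ∘ e, fun i => hpos _, fun i => ?_⟩
    rw [submatrix_mulVec_equiv, Function.comp_assoc, e.self_comp_symm, Function.comp_id]
    exact hv (e i)

end IsNonFiniteType

section Amplitudes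

variable {n : ℕ} {a : ℕ → ℕ → ℕ}

theorem ofAmplitudes_apply_of_ne {i j : Fin n} (hij : i ≠ j) :
    ofAmplitudes n a i j = -(a (i + 1) (j + 1) : ℤ) :=
  if_neg hij

theorem isGCM_ofAmplitudes (ha : ∀ i j, a i j ≠ 0 → a j i ≠ 0) : IsGCM (ofAmplitudes n a) where
  diag _ := if_pos rfl
  nonpos i j hij := by
    rw [ofAmplitudes_apply_of_ne hij]
    exact neg_nonpos.2 (Int.natCast_nonneg _)
  ne_zero_symm i j hM := by
    obtain rfl | hij := eq_or_ne i j
    · exact hM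
    · rw [ofAmplitudes_apply_of_ne hij, neg_ne_zero, Nat.cast_ne_zero] at hM
      rw [ofAmplitudes_apply_of_ne hij.symm, neg_ne_zero, Nat.cast_ne_zero]
      exact ha _ _ hM

theorem exists_fin_add_one_eq {i : ℕ} (hi : i ∈ Icc 1 n) : ∃ k : Fin n, (k : ℕ) + 1 = i := by
  rw [mem_Icc] at hi
  exact ⟨⟨i - 1, by omega⟩, Nat.sub_add_cancel hi.1⟩

theorem connected_graph_ofAmplitudes (ha : ∀ i j, a i j ≠ 0 → a j i ≠ 0) {root : ℕ}
    (hroot : root ∈ Icc 1 n) (rank : ℕ → ℕ)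
    (h : ∀ i ∈ Icc 1 n, i ≠ root → ∃ j ∈ Icc 1 n, a i j ≠ 0 ∧ rank j < rank i) :
    (graph (ofAmplitudes n a)).Connected := by
  obtain ⟨r, rfl⟩ := exists_fin_add_one_eq hroot
  refine connected_of_exists_adj_lt r (fun i => rank (i + 1)) fun i hir => ?_
  obtain ⟨j, hj, hij, hlt⟩ := h (i + 1) (by simp) (by simpa [Fin.ext_iff] using hir)
  obtain ⟨k, rfl⟩ := exists_fin_add_one_eq hj
  have hik : i ≠ k := by rintro rfl; exact hlt.false
  refine ⟨k, (isGCM_ofAmplitudes ha).adj_iff.2 ⟨hik, ?_⟩, hlt⟩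
  rwa [ofAmplitudes_apply_of_ne hik, neg_ne_zero, Nat.cast_ne_zero]

theorem image_univ_erase_add_one (i : Fin n) :
    ((univ.erase i).image fun j : Fin n => (j : ℕ) + 1) = (Icc 1 n).erase (i + 1) := by
  ext k
  constructor
  · simp only [mem_image, mem_erase, mem_univ, and_true, mem_Icc]
    rintro ⟨j, hji, rfl⟩
    omega
  · intro hk
    obtain ⟨j, rfl⟩ := exists_fin_add_one_eq (mem_of_mem_erase hk)
    exact mem_image_of_mem _ (mem_erase.2 ⟨fun h => ne_of_mem_erase hk (by rw [h]), mem_univ j⟩)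

theorem ofAmplitudes_mulVec (w : ℕ → ℕ) (i : Fin n) :
    (ofAmplitudes n a *ᵥ fun j => (w (j + 1) : ℤ)) i =
      2 * w (i + 1) - ∑ j ∈ (Icc 1 n).erase (i + 1), (a (i + 1) j * w j : ℤ) := by
  rw [← image_univ_erase_add_one, sum_image fun j _ k _ hjk => Fin.ext (Nat.succ_injective hjk),
    mulVec, dotProduct, ← add_sum_erase univ _ (mem_univ i), sub_eq_add_neg, ← sum_neg_distrib]
  refine congr_arg₂ _ (congr_arg (· * (w (i + 1) : ℤ)) (if_pos rfl)) (sum_congr rfl fun j hj => ?_)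
  rw [ofAmplitudes_apply_of_ne (ne_of_mem_erase hj).symm, neg_mul]

theorem isNonFiniteType_ofAmplitudes (ha : ∀ i j, a i j ≠ 0 → a j i ≠ 0)
    (hconn : (graph (ofAmplitudes n a)).Connected) (w : ℕ → ℕ) (hw : ∀ i, 0 < w i)
    (h : ∀ i ∈ Icc 1 n, ∃ S ⊆ (Icc 1 n).erase i, 2 * w i ≤ ∑ j ∈ S, a i j * w j) :
    IsNonFiniteType (ofAmplitudes n a) where
  isGCM := isGCM_ofAmplitudes ha
  connected := hconn
  exists_mulVec_nonpos := by
    refine ⟨fun i => w (i + 1), fun i => Int.natCast_pos.2 (hw _), fun i => ?_⟩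
    obtain ⟨S, hS, hle⟩ := h (i + 1) (by simp)
    rw [ofAmplitudes_mulVec, sub_nonpos]
    exact_mod_cast hle.trans (sum_le_sum_of_subset hS)

theorem isNonFiniteType_tildeA (hn : 3 ≤ n) : IsNonFiniteType (tildeA n) := by
  refine isNonFiniteType_ofAmplitudes (by grind)
    (connected_graph_ofAmplitudes (by grind) (root := 1) (by grind) id fun i hi hi1 =>
      ⟨i - 1, by grind, by grind, by grind⟩) (fun _ => 1) (by simp) fun i hi => ?_
  refine ⟨{if i = 1 then n else i - 1, if i = n then 1 else i + 1}, by grind, ?_⟩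
  rw [sum_pair (by grind)]
  grind

theorem isNonFiniteType_ofAmplitudes_path (hn : 2 ≤ n) (ha : ∀ i j, a i j ≠ 0 → a j i ≠ 0)
    (hadj : ∀ i, a (i + 1) i ≠ 0) (w : ℕ → ℕ) (hw : ∀ i, 0 < w i)
    (hfirst : 2 * w 1 ≤ a 1 2 * w 2)
    (hinner : ∀ i ∈ Ioo 1 n, 2 * w i ≤ a i (i - 1) * w (i - 1) + a i (i + 1) * w (i + 1))
    (hlast : 2 * w n ≤ a n (n - 1) * w (n - 1)) : IsNonFiniteType (ofAmplitudes n a) := by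
  refine isNonFiniteType_ofAmplitudes ha
    (connected_graph_ofAmplitudes ha (root := 1) (by grind) id fun i hi hi1 => ?_) w hw
    fun i hi => ?_
  · exact ⟨i - 1, by grind, by grind, by grind⟩
  · obtain rfl | hi1 := eq_or_ne i 1
    · exact ⟨{2}, by grind, by rwa [sum_singleton]⟩
    obtain rfl | hin := eq_or_ne i n
    · exact ⟨{i - 1}, by grind, by rwa [sum_singleton]⟩
    exact ⟨{i - 1, i + 1}, by grind, by rw [sum_pair (by grind)]; exact hinner i (by grind)⟩

theorem isNonFiniteType_tildeB' (hn : 3 ≤ n) : IsNonFiniteType (tildeB' n) :=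
  isNonFiniteType_ofAmplitudes_path (by omega) (by grind) (by grind)
    (fun i => if i = 1 ∨ i = n then 1 else 2) (by grind) (by grind) (by grind) (by grind)

theorem isNonFiniteType_tildeC (hn : 3 ≤ n) : IsNonFiniteType (tildeC n) :=
  isNonFiniteType_ofAmplitudes_path (by omega) (by grind) (by grind) (fun _ => 1) (by simp)
    (by grind) (by grind) (by grind)

theorem isNonFiniteType_tildeC' (hn : 3 ≤ n) : IsNonFiniteType (tildeC' n) :=
  isNonFiniteType_ofAmplitudes_path (by omega) (by grind) (by grind)
    (fun i => if i = 1 then 1 else 2) (by grind) (by grind) (by grind) (by grind)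

theorem isNonFiniteType_ofAmplitudes_fork (hn : 4 ≤ n) (ha : ∀ i j, a i j ≠ 0 → a j i ≠ 0)
    (hadj : ∀ i, 2 ≤ i → a i (i + 1) ≠ 0) (w : ℕ → ℕ) (hw : ∀ i, 0 < w i)
    (hprong₁ : 2 * w 1 ≤ a 1 3 * w 3) (hprong₂ : 2 * w 2 ≤ a 2 3 * w 3)
    (hcenter : 2 * w 3 ≤ a 3 1 * w 1 + a 3 2 * w 2 + a 3 4 * w 4)
    (hinner : ∀ i ∈ Ioo 3 n, 2 * w i ≤ a i (i - 1) * w (i - 1) + a i (i + 1) * w (i + 1))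
    (hlast : 2 * w n ≤ a n (n - 1) * w (n - 1)) : IsNonFiniteType (ofAmplitudes n a) := by
  have hadj₁ : a 1 3 ≠ 0 := fun h => by simp [h, (hw 1).ne'] at hprong₁
  refine isNonFiniteType_ofAmplitudes ha
    (connected_graph_ofAmplitudes ha (root := n) (by grind) (n - ·) fun i hi hin => ?_) w hw
    fun i hi => ?_
  · exact ⟨if i = 1 then 3 else i + 1, by grind, by grind, by grind⟩
  · obtain rfl | hi1 := eq_or_ne i 1
    · exact ⟨{3}, by grind, by rwa [sum_singleton]⟩
    obtain rfl | hi2 := eq_or_ne i 2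
    · exact ⟨{3}, by grind, by rwa [sum_singleton]⟩
    obtain rfl | hi3 := eq_or_ne i 3
    · exact ⟨{1, 2, 4}, by grind, by simpa [add_assoc] using hcenter⟩
    obtain rfl | hin := eq_or_ne i n
    · exact ⟨{i - 1}, by grind, by rwa [sum_singleton]⟩
    exact ⟨{i - 1, i + 1}, by grind, by rw [sum_pair (by grind)]; exact hinner i (by grind)⟩

theorem isNonFiniteType_tildeB (hn : 4 ≤ n) : IsNonFiniteType (tildeB n) :=
  isNonFiniteType_ofAmplitudes_fork hn (by grind) (by grind)
    (fun i => if i ≤ 2 ∨ i = n then 1 else 2) (by grind) (by grind) (by grind) (by grind)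
    (by grind) (by grind)

theorem isNonFiniteType_tildeC'' (hn : 4 ≤ n) : IsNonFiniteType (tildeC'' n) :=
  isNonFiniteType_ofAmplitudes_fork hn (by grind) (by grind) (fun i => if i ≤ 2 then 1 else 2)
    (by grind) (by grind) (by grind) (by grind) (by grind) (by grind)

theorem isNonFiniteType_tildeD (hn : 5 ≤ n) : IsNonFiniteType (tildeD n) := by
  refine isNonFiniteType_ofAmplitudes (by grind)
    (connected_graph_ofAmplitudes (by grind) (root := 3) (by grind)
      (fun i => if i ≤ 2 then 1 else i - 3) fun i hi hi3 =>
        ⟨if i ≤ 2 then 3 else if i = n then n - 2 else i - 1, by grind, by grind, by grind⟩)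
    (fun i => if i ≤ 2 ∨ n ≤ i + 1 then 1 else 2) (by grind) fun i hi => ?_
  by_cases hi2 : i ≤ 2
  · exact ⟨{3}, by grind, by rw [sum_singleton]; grind⟩
  by_cases hin : n ≤ i + 1
  · exact ⟨{n - 2}, by grind, by rw [sum_singleton]; grind⟩
  obtain rfl | hi3 := eq_or_ne i 3
  · obtain rfl | hn5 := eq_or_ne n 5
    · exact ⟨{1, 2, 4, 5}, by decide, by decide⟩
    · exact ⟨{1, 2, 4}, by grind, by rw [sum_insert (by grind), sum_pair (by grind)]; grind⟩
  by_cases hin2 : i + 2 = n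
  · exact ⟨{i - 1, i + 1, n}, by grind, by
      rw [sum_insert (by grind), sum_pair (by grind)]; grind⟩
  exact ⟨{i - 1, i + 1}, by grind, by rw [sum_pair (by grind)]; grind⟩

end Amplitudes

section Sporadic

theorem isNonFiniteType_of_exists_gt_adj {n : ℕ} {M : Matrix (Fin (n + 1)) (Fin (n + 1)) ℤ}
    (v : Fin (n + 1) → ℤ)
    (h : IsGCM M ∧ (∀ i ≠ Fin.last n, ∃ j > i, (graph M).Adj i j) ∧ (∀ i, 0 < v i) ∧
      ∀ i, (M *ᵥ v) i ≤ 0) : IsNonFiniteType M where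
  isGCM := h.1
  connected := connected_of_exists_adj_lt (Fin.last n) OrderDual.toDual fun i hi =>
    let ⟨j, hij, hadj⟩ := h.2.1 i hi
    ⟨j, hadj, hij⟩
  exists_mulVec_nonpos := ⟨v, h.2.2⟩

theorem isNonFiniteType_triangle {m p₁ q₁ p₂ q₂ : ℤ} (hm : 0 < m) (hp₁ : 0 < p₁) (hq₁ : 0 < q₁)
    (hp₂ : 0 < p₂) (hq₂ : 0 < q₂) : IsNonFiniteType (triangle m p₁ q₁ p₂ q₂) := by
  have hM : IsGCM (triangle m p₁ q₁ p₂ q₂) := by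
    constructor <;> simp [triangle, Fin.forall_fin_succ, *, ne_of_gt, le_of_lt]
  have row_sums : triangle m p₁ q₁ p₂ q₂ *ᵥ 1 = ![2 - m - p₁, 1 - p₂, 2 - q₁ - q₂] := by
    ext i
    fin_cases i <;> simp [triangle, mulVec, dotProduct, Fin.sum_univ_succ] <;> ring
  have last_adj : ∀ i ≠ Fin.last 2, triangle m p₁ q₁ p₂ q₂ i (Fin.last 2) ≠ 0 := by
    simp [triangle, Fin.forall_fin_succ, *, ne_of_gt]
  refine isNonFiniteType_of_exists_gt_adj 1 ⟨hM, fun i hi => ⟨Fin.last 2, ?_, ?_⟩, by simp, ?_⟩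
  · exact Fin.lt_last_iff_ne_last.2 hi
  · exact hM.adj_iff.2 ⟨hi, last_adj i hi⟩
  · rw [row_sums]
    intro i
    fin_cases i
    exacts [show 2 - m - p₁ ≤ 0 by omega, show 1 - p₂ ≤ 0 by omega, show 2 - q₁ - q₂ ≤ 0 by omega]

theorem Listed.isNonFiniteType {n : ℕ} {A : Matrix (Fin n) (Fin n) ℤ} (hA : Listed n A) :
    IsNonFiniteType A := by
  cases hA with
  | A _ h => exact isNonFiniteType_tildeA h
  | B _ h => exact isNonFiniteType_tildeB h
  | B' _ h => exact isNonFiniteType_tildeB' h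
  | C _ h => exact isNonFiniteType_tildeC h
  | C' _ h => exact isNonFiniteType_tildeC' h
  | C'' _ h => exact isNonFiniteType_tildeC'' h
  | D _ h => exact isNonFiniteType_tildeD h
  | E6 => exact isNonFiniteType_of_exists_gt_adj ![1, 1, 2, 2, 3, 2, 1] (by decide +kernel)
  | E7 => exact isNonFiniteType_of_exists_gt_adj ![1, 2, 2, 3, 4, 3, 2, 1] (by decide +kernel)
  | E8 => exact isNonFiniteType_of_exists_gt_adj ![2, 3, 4, 6, 5, 4, 3, 2, 1] (by decide +kernel)
  | F => exact isNonFiniteType_of_exists_gt_adj ![2, 4, 3, 2, 1] (by decide +kernel)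
  | F' => exact isNonFiniteType_of_exists_gt_adj ![1, 2, 3, 2, 1] (by decide +kernel)
  | G₄ => exact isNonFiniteType_of_exists_gt_adj ![3, 2, 1] (by decide +kernel)
  | G₁ | G₂ | G₃ | G₅ | G₆ => exact isNonFiniteType_of_exists_gt_adj ![1, 2, 1] (by decide +kernel)
  | triangle₁ _ _ _ _ h₁ h₂ h₃ h₄ => exact isNonFiniteType_triangle (by norm_num) h₁ h₂ h₃ h₄
  | triangle₂ _ _ _ _ h₁ h₂ h₃ h₄ => exact isNonFiniteType_triangle (by norm_num) h₁ h₂ h₃ h₄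
  | triangle₃ _ _ _ _ h₁ h₂ h₃ h₄ => exact isNonFiniteType_triangle (by norm_num) h₁ h₂ h₃ h₄
  | square₁ | square₂ | square₃ => exact isNonFiniteType_of_exists_gt_adj 1 (by decide +kernel)
  | pentagon => exact isNonFiniteType_of_exists_gt_adj 1 (by decide +kernel)

end Sporadic

end NumbersGame

theorem proposition3p1 {ι : Type*} (M : Matrix ι ι ℤ) (hM : NumbersGame.IsListed M) :
    NumbersGame.IsGCM M ∧ (NumbersGame.graph M).Connected ∧ ¬ NumbersGame.Admissible M := by
  obtain ⟨n, A, hA, e, he⟩ := hM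
  obtain rfl : M = A.submatrix e e := Matrix.ext he
  have := Fintype.ofEquiv _ e.symm
  have h := hA.isNonFiniteType.submatrix e
  exact ⟨h.isGCM, h.connected, h.not_admissible⟩
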